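/- Let $\mathcal X=\{\mathsf x_1,\dots,\mathsf x_M\}\subset\mathbb C$ be a constellation of $M$ distinct symbols with $\frac1M\sum_m \mathsf x_m=0$ and $\frac1M\sum_m|\mathsf x_m|^2=1$. For $\gamma\ge 0$ let $I(\gamma)$ be the mutual information, in bits, between $\mathsf X$ and $\mathsf Y=\sqrt{\gamma}\,\mathsf X+\mathsf N$, where $\mathsf X$ is uniformly distributed on $\mathcal X$ and $\mathsf N\sim\mathcal{CN}(0,1)$ is independent of $\mathsf X$. Put $\mathrm{MMSE}(x)=\frac{\mathrm d}{\mathrm dx}I(x)$ for $x>0$, and $\mathcal M[\mathrm{MMSE};2]=\int_0^\infty x\,\mathrm{MMSE}(x)\,\mathrm dx$. Let $K\ge 1$, let $\mathbf R_1,\dots,\mathbf R_K\in\mathbb C^{N\times N}$ be positive semidefinite, and let $\mathbf f=\frac1{\sqrt N}[e^{-j\theta_1},\dots,e^{-j\theta_N}]^{\mathsf T}$ with $\theta_1,\dots,\theta_N\in\mathbb R$ satisfy $\mathbf f^{\mathsf H}\mathbf R_k\mathbf f>0$ for every $k$. Let the channel vectors $\mathbf h_k\sim\mathcal{CN}(\mathbf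 0,\mathbf R_k)$, $k=1,\dots,K$, be independent (that is, $\mathbf h_k$ has the law of $\mathbf R_k^{1/2}\mathbf g$, where $\mathbf g$ has independent $\mathcal{CN}(0,1)$ entries). For an average SNR $\overline\gamma>0$ (transmit power over noise power), the SNR at user $k$ is $\gamma_k=\overline\gamma\,|\mathbf h_k^{\mathsf H}\mathbf f|^2$, and in the non-cooperative scenario the multicast rate is $\min_k I(\gamma_k)$, with expectation (the average multicast rate) $\mathrm{AMR}(\overline\gamma)=\mathbb E\{\min_k I(\gamma_k)\}$. Then $\min_k I(\gamma_k)=I(\min_k\gamma_k)$ and $\mathrm{AMR}(\overline\gamma)$ is well defined for every $\overline\gamma>0$; $I$ is differentiable on $(0,\infty)$; the integral $\mathcal M[\mathrm{MMSE};2]$ converges absolutely and is positive, so that $$d_{\mathrm{non}}=\frac{1}{\mathcal M[\mathrm{MMSE};2]\,\sum_{k=1}^K\frac{1}{\mathbf f^{\mathsf H}\mathbf R_k\mathbf f}}\in(0,\infty);$$ and, as $\overline\gamma\to\infty$, $$\mathrm{AMR}(\overline\gamma)=\log_2 M-\frac{1}{d_{\mathrm{non}}\,\overline\gamma}+o\!\left(\frac1{\overline\gamma}\right).$$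 Consequently the diversity order of the AMR is $1$ and its array gain is $d_{\mathrm{non}}$: $(G_d,G_c)=(1,d_{\mathrm{non}})$ is the only pair of positive numbers for which $\mathrm{AMR}(\overline\gamma)=A\pm(G_c\overline\gamma)^{-G_d}+o(\overline\gamma^{-G_d})$ as $\overline\gamma\to\infty$, for some constant $A$ and some choice of the sign. -/

import Mathlib

open MeasureTheory ProbabilityTheory Filter Asymptotics
open scoped ENNReal NNReal Matrix MatrixOrder ComplexOrder

namespace Multicast

noncomputable section

/-! ### Complex Gaussian laws -/

/-- The standard circularly symmetric complex Gaussian law `CN(0, 1)` on `ℂ`: independent real and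
imaginary parts, each real Gaussian with mean `0` and variance `1 / 2`. -/
def stdComplexGaussian : Measure ℂ :=
  ((gaussianReal 0 (1 / 2)).prod (gaussianReal 0 (1 / 2))).map
    (fun p : ℝ × ℝ => (⟨p.1, p.2⟩ : ℂ))

/-- The law `CN(0, R)` on `ℂ^N` for a positive semidefinite matrix `R`: the law of `R^{1/2} g`,
where the entries of `g` are independent with law `CN(0, 1)`. -/
def complexGaussianVector {N : ℕ} (R : Matrix (Fin N) (Fin N) ℂ) : Measure (Fin N → ℂ) :=
  (Measure.pi (fun _ : Fin N => stdComplexGaussian)).map (fun g => CFC.sqrt R *ᵥ g)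

/-! ### Finite-alphabet input over the complex Gaussian channel -/

/-- An `M`-ary constellation: `M` distinct complex symbols which, taken with equal probabilities,
have mean zero and unit average energy. -/
structure Constellation (M : ℕ) where
  /-- The symbols. -/
  point : Fin M → ℂ
  injective : Function.Injective point
  mean_zero : (M : ℂ)⁻¹ * ∑ m, point m = 0
  unit_energy : (M : ℝ)⁻¹ * ∑ m, ‖point m‖ ^ 2 = 1

/-- The law of a symbol drawn uniformly from the constellation. -/
def Constellation.inputLaw {M : ℕ} (X : Constellation M) : Measure ℂ :=
  (M : ℝ≥0∞)⁻¹ • ∑ m, Measure.dirac (X.point m)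

/-- The joint law of the input `X` and the output `Y = √γ X + N` of the Gaussian channel with
signal-to-noise ratio `γ`, where `N ∼ CN(0, 1)` is independent of the equiprobable symbol `X`. -/
def Constellation.jointLaw {M : ℕ} (X : Constellation M) (γ : ℝ) : Measure (ℂ × ℂ) :=
  (X.inputLaw.prod stdComplexGaussian).map (fun p => (p.1, (Real.sqrt γ : ℂ) * p.1 + p.2))

/-- The mutual information, in bits, of a pair with joint law `ρ`: the relative entropy of `ρ` with
respect to the product of its marginals. -/
def mutualInfoBits {α β : Type*} [MeasurableSpace α] [MeasurableSpace β] (ρ : Measure (α × β)) :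
    ℝ :=
  (InformationTheory.klDiv ρ (ρ.fst.prod ρ.snd)).toReal / Real.log 2

/-- The mutual information `I(γ)` (in bits) between the equiprobable input symbol and the output of
the Gaussian channel with signal-to-noise ratio `γ`. -/
def Constellation.mutualInfo {M : ℕ} (X : Constellation M) (γ : ℝ) : ℝ :=
  mutualInfoBits (X.jointLaw γ)

/-- The function `MMSE(x) = dI(x)/dx`. -/
def Constellation.mmse {M : ℕ} (X : Constellation M) (x : ℝ) : ℝ :=
  deriv X.mutualInfo x

/-- The value at `2` of the Mellin transform of `MMSE`. -/
def Constellation.mmseMellinTwo {M : ℕ} (X : Constellation M) : ℝ :=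
  ∫ x in Set.Ioi (0 : ℝ), x * X.mmse x

/-! ### The multicast channel with analog beamforming -/

/-- The analog beamforming vector with entries `e^{-jθ_n} / √N`. -/
def beamformer {N : ℕ} (θ : Fin N → ℝ) : Fin N → ℂ :=
  fun n => ((Real.sqrt N : ℝ) : ℂ)⁻¹ * Complex.exp (-(Complex.I * (θ n : ℂ)))

/-- The quadratic form `fᴴ R f` (real for Hermitian `R`). -/
def beamGain {N : ℕ} (R : Matrix (Fin N) (Fin N) ℂ) (f : Fin N → ℂ) : ℝ :=
  (star f ⬝ᵥ (R *ᵥ f)).re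

/-- The received signal-to-noise ratio `γ̄ |hᴴ f|²` of a user with channel vector `h`, where `γ̄` is
the ratio of transmit power to noise power. -/
def receivedSNR {N : ℕ} (γbar : ℝ) (f h : Fin N → ℂ) : ℝ :=
  γbar * ‖star h ⬝ᵥ f‖ ^ 2

/-- The non-cooperative multicast rate `min_k I(γ_k)` for given channel vectors. -/
def multicastRate {M N K : ℕ} (X : Constellation M) (γbar : ℝ) (f : Fin N → ℂ)
    (h : Fin K → Fin N → ℂ) : ℝ :=
  ⨅ k, X.mutualInfo (receivedSNR γbar f (h k))

/-- The average multicast rate: the expectation of the multicast rate over the random channel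
vectors. -/
def averageMulticastRate {M N K : ℕ} {Ω : Type*} [MeasurableSpace Ω] (P : Measure Ω)
    (X : Constellation M) (γbar : ℝ) (f : Fin N → ℂ) (h : Fin K → Ω → Fin N → ℂ) : ℝ :=
  ∫ ω, multicastRate X γbar f (fun k => h k ω) ∂P

/-- The constant `d_non`. -/
def arrayGainNon {M N K : ℕ} (X : Constellation M) (f : Fin N → ℂ)
    (R : Fin K → Matrix (Fin N) (Fin N) ℂ) : ℝ :=
  1 / (X.mmseMellinTwo * ∑ k, 1 / beamGain (R k) f)

/-- A performance metric `F`, as a function of the average SNR, has diversity order `Gd` and array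
gain `Gc` if, at high SNR, it behaves like `A + (Gc · SNR)^{-Gd}` or `A - (Gc · SNR)^{-Gd}` for some
constant `A`, with an error of smaller order than `SNR^{-Gd}`. -/
def HasDiversityOrderAndArrayGain (F : ℝ → ℝ) (Gd Gc : ℝ) : Prop :=
  0 < Gd ∧ 0 < Gc ∧ ∃ A s : ℝ, (s = 1 ∨ s = -1) ∧
    (fun γ : ℝ => F γ - (A + s * (Gc * γ) ^ (-Gd))) =o[atTop] (fun γ : ℝ => γ ^ (-Gd))

end

end Multicast

/-!
The proof expresses everything through the rate loss `L(γ) = log₂ M - I(γ)`, which is the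
conditional entropy of the input symbol given the channel output.

Relative to `CN(0, 1)`, the output given `X = x_m` has an explicit exponential density (translation
of a Gaussian), so the mutual information is `log M` minus the equivocation, a finite sum of
Gaussian expectations of logarithms of sums of exponentials (`Constellation.mutualInfo_eq`). Three
properties of the equivocation follow.

* It decreases with the SNR (`Constellation.equivocation_anti`): by stability of the Gaussian law
  the output at a smaller SNR is a noisy rescaled copy of the output at a larger SNR, and by Gibbs'
  inequality the posterior of the larger SNR predicts the symbol at least as well. Hence `I` is
  monotone, so that it commutes with the minimum over users, and `MMSE = I'` is nonnegative.
* It is differentiable in the amplitude (`Constellation.differentiable_equivocation`).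
* It is positive and decays exponentially in the SNR (`Constellation.equivocation_le`), so `L` is
  integrable on `(0, ∞)`, and integration by parts gives `∫ x I'(x) dx = ∫ L(x) dx ∈ (0, ∞)`
  (`Constellation.mmseMellinTwo_eq`).

On the channel side, `h_kᴴ f` is a complex Gaussian variable with variance `fᴴ R_k f`, so the gains
`|h_kᴴ f|²` are independent exponential variables and their minimum is exponential with rate
`r = ∑ₖ 1 / fᴴ R_k f` (`map_iInf_gain`). Therefore
`log₂ M - AMR(γ) = ∫₀^∞ r e^{-r z} L(γ z) dz = (r / γ) ∫₀^∞ e^{-r u / γ} L(u) du`,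
and dominated convergence shows that `γ (log₂ M - AMR(γ))` tends to `r ∫ L`, the inverse of `d_non`
(`tendsto_mul_averageMulticastRate`). An expansion with a nonzero term of order `1 / γ` admits only
one diversity order and one array gain (`hasDiversityOrderAndArrayGain_iff`).
-/

namespace Multicast

/-! ### The standard complex Gaussian law -/

instance isProbabilityMeasure_stdComplexGaussian :
    IsProbabilityMeasure stdComplexGaussian :=
  Measure.isProbabilityMeasure_map (by
    exact Complex.measurableEquivRealProd.symm.measurable.aemeasurable)

/-- The density of `CN(0, 1)` with respect to Lebesgue measure on `ℂ`. -/
noncomputable def complexGaussianPDF (z : ℂ) : ℝ≥0∞ :=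
  ENNReal.ofReal (Real.pi⁻¹ * Real.exp (-‖z‖ ^ 2))

lemma measurable_complexGaussianPDF : Measurable complexGaussianPDF := by
  unfold complexGaussianPDF
  fun_prop

lemma gaussianPDF_mul_gaussianPDF (x y : ℝ) :
    gaussianPDF 0 (1 / 2) x * gaussianPDF 0 (1 / 2) y = complexGaussianPDF ⟨x, y⟩ := by
  rw [gaussianPDF, gaussianPDF, complexGaussianPDF,
    ← ENNReal.ofReal_mul (gaussianPDFReal_nonneg _ _ _), gaussianPDFReal, gaussianPDFReal]
  congr 1
  have h2 : ((1 / 2 : ℝ≥0) : ℝ) = 1 / 2 := by norm_num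
  have h3 : (2 * Real.pi * (1 / 2 : ℝ)) = Real.pi := by ring
  have h4 : (2 * (1 / 2 : ℝ)) = 1 := by ring
  rw [h2, h3, h4, ← Complex.normSq_eq_norm_sq, Complex.normSq_mk]
  rw [mul_mul_mul_comm, ← Real.exp_add, ← mul_inv, Real.mul_self_sqrt Real.pi_pos.le]
  congr 2
  ring

lemma stdComplexGaussian_eq_withDensity :
    stdComplexGaussian = volume.withDensity complexGaussianPDF := by
  have hv : (1 / 2 : ℝ≥0) ≠ 0 := by norm_num
  ext s hs
  have hm : Measurable (fun p : ℝ × ℝ => (⟨p.1, p.2⟩ : ℂ)) :=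
    Complex.measurableEquivRealProd.symm.measurable
  rw [stdComplexGaussian, Measure.map_apply hm hs, gaussianReal_of_var_ne_zero 0 hv,
    prod_withDensity (measurable_gaussianPDF _ _) (measurable_gaussianPDF _ _),
    withDensity_apply _ (hm hs), withDensity_apply _ hs, ← Measure.volume_eq_prod]
  have h := (Complex.volume_preserving_equiv_real_prod.symm).setLIntegral_comp_preimage_emb
    Complex.measurableEquivRealProd.symm.measurableEmbedding complexGaussianPDF s
  rw [← h]
  refine lintegral_congr fun p => ?_
  exact gaussianPDF_mul_gaussianPDF p.1 p.2

/-- Translating `CN(0, 1)` by `a` multiplies it by the density `exp (2 Re (ā z) - |a|²)`. -/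
lemma map_const_add_stdComplexGaussian (a : ℂ) :
    stdComplexGaussian.map (fun z => a + z) =
      stdComplexGaussian.withDensity
        (fun z => ENNReal.ofReal (Real.exp (2 * (star a * z).re - ‖a‖ ^ 2))) := by
  ext s hs
  rw [Measure.map_apply (by fun_prop) hs, stdComplexGaussian_eq_withDensity,
    withDensity_apply _ ((by fun_prop : Measurable fun z : ℂ => a + z) hs),
    ← withDensity_mul _ measurable_complexGaussianPDF (by fun_prop), withDensity_apply _ hs,
    ← (measurePreserving_add_left volume a).setLIntegral_comp_preimage_emb
      (measurableEmbedding_addLeft a) _ s]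
  refine lintegral_congr fun z => ?_
  simp only [Pi.mul_apply, complexGaussianPDF]
  rw [← ENNReal.ofReal_mul (by positivity), mul_assoc, ← Real.exp_add]
  congr 3
  simp only [← Complex.normSq_eq_norm_sq, Complex.normSq_apply, Complex.star_def, Complex.add_re,
    Complex.add_im, Complex.mul_re, Complex.conj_re, Complex.conj_im]
  ring

lemma integral_const_add_stdComplexGaussian (a : ℂ) (g : ℂ → ℝ) :
    ∫ z, g (a + z) ∂stdComplexGaussian =
      ∫ z, Real.exp (2 * (star a * z).re - ‖a‖ ^ 2) * g z ∂stdComplexGaussian := by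
  rw [← (measurableEmbedding_addLeft a).integral_map g, map_const_add_stdComplexGaussian,
    integral_withDensity_eq_integral_toReal_smul (by fun_prop) (by simp)]
  refine integral_congr_ae (.of_forall fun z => ?_)
  simp [ENNReal.toReal_ofReal (Real.exp_pos _).le]

lemma integrable_const_add_stdComplexGaussian_iff (a : ℂ) (g : ℂ → ℝ) :
    Integrable (fun z => g (a + z)) stdComplexGaussian ↔
      Integrable (fun z => Real.exp (2 * (star a * z).re - ‖a‖ ^ 2) * g z)
        stdComplexGaussian := by
  rw [← Function.comp_def g, ← (measurableEmbedding_addLeft a).integrable_map_iff,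
    map_const_add_stdComplexGaussian,
    integrable_withDensity_iff_integrable_smul₀' (by fun_prop) (by simp)]
  refine integrable_congr (.of_forall fun z => ?_)
  simp [ENNReal.toReal_ofReal (Real.exp_pos _).le]

lemma integrable_exp_re_stdComplexGaussian (a : ℂ) :
    Integrable (fun z => Real.exp (2 * (star a * z).re)) stdComplexGaussian := by
  have h := (integrable_const_add_stdComplexGaussian_iff a (fun _ => 1)).1 (by simp)
  refine (h.const_mul (Real.exp (‖a‖ ^ 2))).congr (.of_forall fun z => ?_)
  simp only [mul_one]
  rw [← Real.exp_add]
  congr 1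
  ring

lemma integrable_abs_re_stdComplexGaussian (a : ℂ) :
    Integrable (fun z => |2 * (star a * z).re|) stdComplexGaussian := by
  refine Integrable.mono' ((integrable_exp_re_stdComplexGaussian a).add
    (integrable_exp_re_stdComplexGaussian (-a)))
    (by fun_prop : Measurable _).aestronglyMeasurable (.of_forall fun z => ?_)
  have h1 := Real.add_one_le_exp (2 * (star a * z).re)
  have h2 := Real.add_one_le_exp (-(2 * (star a * z).re))
  have h3 := Real.exp_pos (2 * (star a * z).re)
  have h4 := Real.exp_pos (-(2 * (star a * z).re))
  simp only [Pi.add_apply, star_neg, neg_mul, Complex.neg_re, mul_neg, norm_abs_eq_norm,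
    Real.norm_eq_abs]
  exact abs_le.2 ⟨by linarith, by linarith⟩

lemma integral_exp_re_stdComplexGaussian (a : ℂ) :
    ∫ z, Real.exp (2 * (star a * z).re) ∂stdComplexGaussian = Real.exp (‖a‖ ^ 2) := by
  have h := integral_const_add_stdComplexGaussian a (fun _ => 1)
  simp only [integral_const, probReal_univ, smul_eq_mul, mul_one, Real.exp_sub,
    integral_div] at h
  field_simp at h
  exact h.symm

lemma charFun_stdComplexGaussian (t : ℂ) :
    charFun stdComplexGaussian t = Complex.exp (-(‖t‖ ^ 2 : ℝ) / 4) := by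
  have hm : Measurable (fun p : ℝ × ℝ => (⟨p.1, p.2⟩ : ℂ)) :=
    Complex.measurableEquivRealProd.symm.measurable
  have h : ∀ x : ℝ, ∫ y, Complex.exp (x * y * Complex.I) ∂gaussianReal 0 (1 / 2) =
      Complex.exp (-(x ^ 2 : ℝ) / 4) := by
    intro x
    rw [← charFun_apply_real, charFun_gaussianReal]
    congr 1
    push_cast
    ring
  rw [charFun_apply, stdComplexGaussian,
    integral_map hm.aemeasurable (by fun_prop : Measurable _).aestronglyMeasurable]
  calc ∫ p : ℝ × ℝ, Complex.exp (inner ℝ (⟨p.1, p.2⟩ : ℂ) t * Complex.I)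
        ∂(gaussianReal 0 (1 / 2)).prod (gaussianReal 0 (1 / 2))
      = ∫ p : ℝ × ℝ, Complex.exp (t.re * p.1 * Complex.I) * Complex.exp (t.im * p.2 * Complex.I)
        ∂(gaussianReal 0 (1 / 2)).prod (gaussianReal 0 (1 / 2)) := by
        refine integral_congr_ae (.of_forall fun p => ?_)
        simp only [← Complex.exp_add, Complex.inner]
        congr 1
        simp
        ring
    _ = _ := by
        rw [integral_prod_mul (fun x : ℝ => Complex.exp (t.re * x * Complex.I))
          (fun y : ℝ => Complex.exp (t.im * y * Complex.I)), h, h, ← Complex.exp_add]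
        congr 1
        rw [← Complex.normSq_eq_norm_sq, Complex.normSq_apply]
        push_cast
        ring

lemma charFun_map_const_mul_stdComplexGaussian (c t : ℂ) :
    charFun (stdComplexGaussian.map (fun z => c * z)) t =
      Complex.exp (-(‖c‖ ^ 2 * ‖t‖ ^ 2 : ℝ) / 4) := by
  have h := charFun_stdComplexGaussian (star c * t)
  rw [norm_mul, norm_star, mul_pow] at h
  rw [← h, charFun_apply, charFun_apply,
    integral_map (by fun_prop) (by fun_prop : Measurable _).aestronglyMeasurable]
  refine integral_congr_ae (.of_forall fun z => ?_)
  simp only [Complex.inner]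
  congr 3
  simp
  ring

/-- Stability of the complex Gaussian law under normalised linear combinations. -/
lemma map_add_prod_stdComplexGaussian (a b : ℝ) (hab : a ^ 2 + b ^ 2 = 1) :
    (stdComplexGaussian.prod stdComplexGaussian).map (fun p => (a : ℂ) * p.1 + (b : ℂ) * p.2) =
      stdComplexGaussian := by
  have h1 : (stdComplexGaussian.prod stdComplexGaussian).map
      (fun p => (a : ℂ) * p.1 + (b : ℂ) * p.2) =
      ((stdComplexGaussian.map (fun z => (a : ℂ) * z)).prod
        (stdComplexGaussian.map (fun z => (b : ℂ) * z))).map (fun p => p.1 + p.2) := by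
    rw [Measure.map_prod_map _ _ (by fun_prop) (by fun_prop), Measure.map_map (by fun_prop)
      (by fun_prop)]
    rfl
  have := Measure.isProbabilityMeasure_map (μ := stdComplexGaussian)
    (f := fun z => (a : ℂ) * z) (by fun_prop)
  have := Measure.isProbabilityMeasure_map (μ := stdComplexGaussian)
    (f := fun z => (b : ℂ) * z) (by fun_prop)
  have := Measure.isProbabilityMeasure_map (μ := stdComplexGaussian.prod stdComplexGaussian)
    (f := fun p => (a : ℂ) * p.1 + (b : ℂ) * p.2) (by fun_prop)
  refine Measure.ext_of_charFun (funext fun t => ?_)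
  rw [h1, charFun_map_add_prod_eq_mul, Pi.mul_apply, charFun_map_const_mul_stdComplexGaussian,
    charFun_map_const_mul_stdComplexGaussian, charFun_stdComplexGaussian, ← Complex.exp_add]
  congr 1
  rw [← add_div, ← Complex.ofReal_neg, ← Complex.ofReal_neg, ← Complex.ofReal_neg,
    ← Complex.ofReal_add]
  congr 2
  simp only [Complex.norm_real, Real.norm_eq_abs, sq_abs]
  linear_combination (-‖t‖ ^ 2) * hab

/-- A linear combination of independent `CN(0, 1)` variables with coefficients `c` has the law of
`‖c‖ Z` with `Z ∼ CN(0, 1)`. -/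
lemma map_sum_mul_pi_stdComplexGaussian {N : ℕ} (c : Fin N → ℂ) :
    (Measure.pi (fun _ : Fin N => stdComplexGaussian)).map (fun g => ∑ i, c i * g i) =
      stdComplexGaussian.map (fun z => (Real.sqrt (∑ i, ‖c i‖ ^ 2) : ℂ) * z) := by
  have hp : ∀ i, IsProbabilityMeasure (stdComplexGaussian.map (fun z => c i * z)) := fun i =>
    Measure.isProbabilityMeasure_map (by fun_prop)
  have h1 : (Measure.pi (fun _ : Fin N => stdComplexGaussian)).map (fun g => ∑ i, c i * g i) =
      (Measure.pi (fun i : Fin N => stdComplexGaussian.map (fun z => c i * z))).map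
        (fun g => ∑ i, g i) := by
    rw [← Measure.pi_map_pi (fun i => (by fun_prop)), Measure.map_map (by fun_prop)
      (by fun_prop)]
    rfl
  have := Measure.isProbabilityMeasure_map (μ := stdComplexGaussian)
    (f := fun z => (Real.sqrt (∑ i, ‖c i‖ ^ 2) : ℂ) * z) (by fun_prop)
  have := Measure.isProbabilityMeasure_map
    (μ := Measure.pi (fun _ : Fin N => stdComplexGaussian))
    (f := fun g => ∑ i, c i * g i)
    (Finset.measurable_sum _ fun i _ =>
      ((measurable_pi_apply i : Measurable fun g : Fin N → ℂ => g i).const_mul (c i))).aemeasurable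
  refine Measure.ext_of_charFun (funext fun t => ?_)
  rw [h1, charFun_map_sum_pi_eq_prod, Finset.prod_apply,
    charFun_map_const_mul_stdComplexGaussian]
  simp only [charFun_map_const_mul_stdComplexGaussian]
  rw [← Complex.exp_sum]
  congr 1
  rw [Complex.norm_real, Real.norm_eq_abs, sq_abs, Real.sq_sqrt (by positivity),
    Finset.sum_mul, ← Finset.sum_div, Finset.sum_neg_distrib]
  push_cast
  rfl

/-- The squared modulus of a `CN(0, 1)` variable is exponential with mean `1`. -/
lemma stdComplexGaussian_norm_sq_gt {t : ℝ} (ht : 0 ≤ t) :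
    stdComplexGaussian {z | t < ‖z‖ ^ 2} = ENNReal.ofReal (Real.exp (-t)) := by
  have hs : MeasurableSet {z : ℂ | t < ‖z‖ ^ 2} :=
    measurableSet_lt measurable_const (by fun_prop)
  rw [← ENNReal.ofReal_toReal (measure_ne_top stdComplexGaussian {z | t < ‖z‖ ^ 2})]
  congr 1
  change stdComplexGaussian.real _ = _
  rw [← integral_indicator_one hs, stdComplexGaussian_eq_withDensity,
    integral_withDensity_eq_integral_toReal_smul measurable_complexGaussianPDF
      (by simp [complexGaussianPDF])]
  have h1 : ∀ z : ℂ, (complexGaussianPDF z).toReal • ({z : ℂ | t < ‖z‖ ^ 2}.indicator 1 z : ℝ) =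
      (fun r : ℝ => (Set.Ioi √t).indicator (fun r => Real.pi⁻¹ * Real.exp (-r ^ 2)) r) ‖z‖ := by
    intro z
    have h2 : √t < ‖z‖ ↔ t < ‖z‖ ^ 2 := Real.sqrt_lt ht (norm_nonneg z)
    simp only [Set.indicator, Set.mem_Ioi, Set.mem_ofPred_eq, h2, complexGaussianPDF]
    split_ifs
    · simp [ENNReal.toReal_ofReal (by positivity : 0 ≤ Real.pi⁻¹ * Real.exp (-‖z‖ ^ 2))]
    · simp
  simp_rw [h1]
  rw [integral_fun_norm_addHaar]
  have h3 : ∫ y in Set.Ioi (0 : ℝ), y ^ (Module.finrank ℝ ℂ - 1) •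
      (Set.Ioi √t).indicator (fun r => Real.pi⁻¹ * Real.exp (-r ^ 2)) y =
      ∫ y in Set.Ioi √t, Real.pi⁻¹ * (y * Real.exp (-y ^ 2)) := by
    rw [← integral_indicator measurableSet_Ioi, ← integral_indicator measurableSet_Ioi]
    refine integral_congr_ae (.of_forall fun y => ?_)
    by_cases hy : √t < y
    · have hy0 : 0 < y := (Real.sqrt_nonneg t).trans_lt hy
      simp [Set.indicator, hy, hy0]
      ring
    · simp [Set.indicator, hy]
  have h4 : ∫ y in Set.Ioi √t, y * Real.exp (-y ^ 2) = Real.exp (-t) / 2 := by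
    have hd : ∀ x ∈ Set.Ici √t, HasDerivAt (fun y : ℝ => -Real.exp (-y ^ 2) / 2)
        (x * Real.exp (-x ^ 2)) x := by
      intro x _
      refine ((hasDerivAt_pow 2 x).fun_neg.exp.fun_neg.div_const 2).congr_deriv ?_
      push_cast
      ring
    have hlim : Tendsto (fun y : ℝ => -Real.exp (-y ^ 2) / 2) atTop (nhds 0) := by
      have : Tendsto (fun y : ℝ => Real.exp (-y ^ 2)) atTop (nhds 0) :=
        Real.tendsto_exp_neg_atTop_nhds_zero.comp (tendsto_pow_atTop two_ne_zero)
      simpa using this.neg.div_const 2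
    rw [integral_Ioi_of_hasDerivAt_of_nonneg' hd (fun x hx => mul_nonneg
      ((Real.sqrt_nonneg t).trans (le_of_lt hx)) (Real.exp_pos _).le) hlim, Real.sq_sqrt ht]
    ring
  rw [h3, integral_const_mul, h4, Complex.finrank_real_complex, measureReal_def,
    Complex.volume_ball]
  simp
  field_simp

/-! ### Equivocation of the channel input -/

/-- The density at `y` of the law `CN(a, 1)` relative to `CN(0, 1)`. -/
noncomputable def gaussianLikelihood (a y : ℂ) : ℝ :=
  Real.exp (2 * (star a * y).re - ‖a‖ ^ 2)

lemma gaussianLikelihood_pos (a y : ℂ) : 0 < gaussianLikelihood a y := Real.exp_pos _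

lemma measurable_gaussianLikelihood : Measurable (fun p : ℂ × ℂ => gaussianLikelihood p.1 p.2) := by
  unfold gaussianLikelihood
  have : Continuous fun p : ℂ × ℂ => Real.exp (2 * (star p.1 * p.2).re - ‖p.1‖ ^ 2) := by fun_prop
  exact this.measurable

lemma gaussianLikelihood_div (a b n : ℂ) :
    gaussianLikelihood b (a + n) / gaussianLikelihood a (a + n) =
      Real.exp (-‖a - b‖ ^ 2 - 2 * (star (a - b) * n).re) := by
  rw [gaussianLikelihood, gaussianLikelihood, ← Real.exp_sub]
  congr 1
  simp only [← Complex.normSq_eq_norm_sq, Complex.normSq_apply, Complex.star_def, Complex.add_re,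
    Complex.add_im, Complex.sub_re, Complex.sub_im, Complex.mul_re, Complex.conj_re,
    Complex.conj_im]
  ring

/-- An elementary bound which turns the logarithm of a sum of exponentials into a sum of
exponentials with halved exponents, whose Gaussian means are explicit and decay. -/
lemma log_one_add_sum_sq_le {ι : Type*} (t : Finset ι) (b : ι → ℝ) (hb : ∀ i ∈ t, 0 ≤ b i) :
    Real.log (1 + ∑ i ∈ t, b i ^ 2) ≤ 2 * ∑ i ∈ t, b i := by
  have h0 : 0 ≤ ∑ i ∈ t, b i := Finset.sum_nonneg hb
  have h1 : 0 ≤ ∑ i ∈ t, b i ^ 2 := Finset.sum_nonneg fun i _ => sq_nonneg _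
  have h2 : ∑ i ∈ t, b i ^ 2 ≤ (∑ i ∈ t, b i) ^ 2 := Finset.sum_sq_le_sq_sum_of_nonneg hb
  calc Real.log (1 + ∑ i ∈ t, b i ^ 2) ≤ Real.log ((1 + ∑ i ∈ t, b i) ^ 2) :=
        Real.log_le_log (by positivity) (by nlinarith)
    _ = 2 * Real.log (1 + ∑ i ∈ t, b i) := by rw [Real.log_pow]; norm_num
    _ ≤ 2 * ∑ i ∈ t, b i := by
        have := Real.log_le_sub_one_of_pos (by positivity : 0 < 1 + ∑ i ∈ t, b i)
        linarith

namespace Constellation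

variable {M : ℕ} (X : Constellation M)

/-- A single symbol of mean zero would have no energy, so there are at least two symbols. -/
lemma two_le_card {M : ℕ} (X : Constellation M) : 2 ≤ M := by
  rcases M with _ | _ | M
  · simpa using X.unit_energy
  · have h := X.unit_energy
    have h0 := X.mean_zero
    simp at h h0
    simp [h0] at h
  · omega

lemma card_pos {M : ℕ} (X : Constellation M) : 0 < (M : ℝ) := by
  have := X.two_le_card
  positivity

lemma exists_ne {M : ℕ} (X : Constellation M) (m : Fin M) : ∃ m', m' ≠ m :=
  have := Fin.nontrivial_iff_two_le.2 X.two_le_card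
  _root_.exists_ne m

/-- The information (in nats) `-log P(X = x_m | Y = y)` left in the symbol `x_m` once the output
`Y = s X + N` is observed to be `y`. -/
noncomputable def posteriorInfo (s : ℝ) (m : Fin M) (y : ℂ) : ℝ :=
  Real.log ((∑ m', gaussianLikelihood (s * X.point m') y) / gaussianLikelihood (s * X.point m) y)

/-- The equivocation (conditional entropy) `H(X | s X + N)` in nats of the equiprobable symbol
given the output at amplitude `s`. -/
noncomputable def equivocation (s : ℝ) : ℝ :=
  (M : ℝ)⁻¹ * ∑ m, ∫ n, X.posteriorInfo s m (s * X.point m + n) ∂stdComplexGaussian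

lemma sum_gaussianLikelihood_pos (s : ℝ) (y : ℂ) :
    0 < ∑ m', gaussianLikelihood (s * X.point m') y :=
  have : Nonempty (Fin M) := ⟨⟨0, by have := X.two_le_card; omega⟩⟩
  Finset.sum_pos (fun _ _ => gaussianLikelihood_pos _ _) Finset.univ_nonempty

lemma measurable_posteriorInfo (s : ℝ) (m : Fin M) : Measurable (X.posteriorInfo s m) := by
  have h : ∀ a, Measurable (gaussianLikelihood a) := fun a =>
    measurable_gaussianLikelihood.comp measurable_prodMk_left
  exact ((Finset.measurable_sum _ fun i _ => h _).div (h _)).log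

lemma exp_neg_posteriorInfo (s : ℝ) (m : Fin M) (y : ℂ) :
    Real.exp (-X.posteriorInfo s m y) =
      gaussianLikelihood (s * X.point m) y / ∑ m', gaussianLikelihood (s * X.point m') y := by
  rw [posteriorInfo, ← Real.log_inv, inv_div, Real.exp_log]
  exact div_pos (gaussianLikelihood_pos _ _) (X.sum_gaussianLikelihood_pos s y)

lemma sum_exp_neg_posteriorInfo (s : ℝ) (y : ℂ) :
    ∑ m, Real.exp (-X.posteriorInfo s m y) = 1 := by
  simp_rw [exp_neg_posteriorInfo]
  rw [← Finset.sum_div, div_self (X.sum_gaussianLikelihood_pos s y).ne']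

/-- The posterior information along the true output, in terms of the noise alone. -/
lemma posteriorInfo_add (s : ℝ) (m : Fin M) (n : ℂ) :
    X.posteriorInfo s m (s * X.point m + n) =
      Real.log (∑ m', Real.exp (-(s ^ 2 * ‖X.point m - X.point m'‖ ^ 2) -
        2 * s * (star (X.point m - X.point m') * n).re)) := by
  rw [posteriorInfo, Finset.sum_div]
  congr 2 with m'
  rw [gaussianLikelihood_div, ← mul_sub, norm_mul, mul_pow, star_mul']
  simp only [Complex.norm_real, Real.norm_eq_abs, sq_abs, Complex.star_def, Complex.conj_ofReal,
    mul_assoc, Complex.re_ofReal_mul]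

lemma posteriorInfo_add_eq_log_one_add (s : ℝ) (m : Fin M) (n : ℂ) :
    X.posteriorInfo s m (s * X.point m + n) =
      Real.log (1 + ∑ m' ∈ Finset.univ.erase m,
        Real.exp (-(s ^ 2 * ‖X.point m - X.point m'‖ ^ 2) -
          2 * s * (star (X.point m - X.point m') * n).re)) := by
  rw [posteriorInfo_add, ← Finset.add_sum_erase _ _ (Finset.mem_univ m)]
  simp

lemma posteriorInfo_add_pos (s : ℝ) (m : Fin M) (n : ℂ) :
    0 < X.posteriorInfo s m (s * X.point m + n) := by
  rw [posteriorInfo_add_eq_log_one_add]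
  refine Real.log_pos (lt_add_of_pos_right 1 (Finset.sum_pos (fun _ _ => Real.exp_pos _) ?_))
  obtain ⟨m', hm'⟩ := X.exists_ne m
  exact ⟨m', by simp [hm']⟩

lemma posteriorInfo_add_le (s : ℝ) (m : Fin M) (n : ℂ) :
    X.posteriorInfo s m (s * X.point m + n) ≤
      2 * ∑ m' ∈ Finset.univ.erase m, Real.exp (-(s ^ 2 * ‖X.point m - X.point m'‖ ^ 2) / 2) *
        Real.exp (2 * (star (-((s / 2 : ℝ) * (X.point m - X.point m'))) * n).re) := by
  rw [posteriorInfo_add_eq_log_one_add]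
  refine le_trans (le_of_eq ?_) (log_one_add_sum_sq_le _ _ fun i _ => by positivity)
  congr 2
  refine Finset.sum_congr rfl fun m' _ => ?_
  rw [← Real.exp_add, ← Real.exp_nat_mul]
  congr 1
  rw [star_neg, star_mul', Complex.star_def, Complex.conj_ofReal, neg_mul,
    Complex.neg_re, mul_assoc ((s / 2 : ℝ) : ℂ), Complex.re_ofReal_mul]
  push_cast
  ring

lemma integrable_posteriorInfo_add (s : ℝ) (m : Fin M) :
    Integrable (fun n => X.posteriorInfo s m (s * X.point m + n)) stdComplexGaussian := by
  refine Integrable.mono' (g := fun n => 2 * ∑ m' ∈ Finset.univ.erase m,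
      Real.exp (-(s ^ 2 * ‖X.point m - X.point m'‖ ^ 2) / 2) *
        Real.exp (2 * (star (-((s / 2 : ℝ) * (X.point m - X.point m'))) * n).re))
    ((integrable_finsetSum _ fun m' _ =>
    (integrable_exp_re_stdComplexGaussian _).const_mul _).const_mul 2)
    ((X.measurable_posteriorInfo s m).comp (by fun_prop)).aestronglyMeasurable
    (.of_forall fun n => ?_)
  rw [Real.norm_of_nonneg (X.posteriorInfo_add_pos s m n).le]
  exact X.posteriorInfo_add_le s m n

lemma equivocation_pos (s : ℝ) : 0 < X.equivocation s := by
  have : Nonempty (Fin M) := ⟨⟨0, by have := X.two_le_card; omega⟩⟩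
  refine mul_pos (inv_pos.2 X.card_pos) (Finset.sum_pos (fun m _ => ?_) Finset.univ_nonempty)
  rw [integral_pos_iff_support_of_nonneg (fun n => (X.posteriorInfo_add_pos s m n).le)
    (X.integrable_posteriorInfo_add s m)]
  have : Function.support (fun n => X.posteriorInfo s m (s * X.point m + n)) = Set.univ :=
    Set.eq_univ_of_forall fun n => (X.posteriorInfo_add_pos s m n).ne'
  simp [this]

/-- Exponential decay of the equivocation in the signal-to-noise ratio `s ^ 2`. -/
lemma equivocation_le (s : ℝ) :
    X.equivocation s ≤ (M : ℝ)⁻¹ * ∑ m, 2 * ∑ m' ∈ Finset.univ.erase m,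
      Real.exp (-(‖X.point m - X.point m'‖ ^ 2 / 4 * s ^ 2)) := by
  refine mul_le_mul_of_nonneg_left (Finset.sum_le_sum fun m _ => ?_) (inv_pos.2 X.card_pos).le
  refine (integral_mono (X.integrable_posteriorInfo_add s m) ((integrable_finsetSum _ fun m' _ =>
    (integrable_exp_re_stdComplexGaussian _).const_mul _).const_mul 2)
    (X.posteriorInfo_add_le s m)).trans_eq ?_
  rw [integral_const_mul, integral_finsetSum _ fun m' _ =>
    (integrable_exp_re_stdComplexGaussian _).const_mul _]
  congr 1
  refine Finset.sum_congr rfl fun m' _ => ?_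
  rw [integral_const_mul, integral_exp_re_stdComplexGaussian, ← Real.exp_add, norm_neg, norm_mul,
    Complex.norm_real, mul_pow, Real.norm_eq_abs, sq_abs]
  congr 1
  ring

/-! ### Mutual information as `log M` minus the equivocation -/

instance isProbabilityMeasure_inputLaw : IsProbabilityMeasure X.inputLaw := by
  refine ⟨?_⟩
  have : (M : ℝ≥0∞) ≠ 0 := by have := X.two_le_card; simp; omega
  simp [inputLaw, ENNReal.inv_mul_cancel this (by simp)]

lemma lintegral_inputLaw_prod (μ : Measure ℂ) [SFinite μ] {g : ℂ × ℂ → ℝ≥0∞} (hg : Measurable g) :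
    ∫⁻ p, g p ∂(X.inputLaw.prod μ) = (M : ℝ≥0∞)⁻¹ * ∑ m, ∫⁻ y, g (X.point m, y) ∂μ := by
  rw [lintegral_prod _ hg.aemeasurable, inputLaw, lintegral_smul_measure,
    lintegral_finsetSum_measure, smul_eq_mul]
  simp_rw [lintegral_dirac]

lemma lintegral_jointLaw (γ : ℝ) {g : ℂ × ℂ → ℝ≥0∞} (hg : Measurable g) :
    ∫⁻ p, g p ∂(X.jointLaw γ) = (M : ℝ≥0∞)⁻¹ *
      ∑ m, ∫⁻ n, g (X.point m, (√γ : ℂ) * X.point m + n) ∂stdComplexGaussian := by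
  rw [jointLaw, lintegral_map hg (by fun_prop),
    lintegral_inputLaw_prod X stdComplexGaussian
      (g := fun p => g (p.1, (√γ : ℂ) * p.1 + p.2)) (hg.comp (by fun_prop))]

instance isProbabilityMeasure_jointLaw (γ : ℝ) : IsProbabilityMeasure (X.jointLaw γ) :=
  Measure.isProbabilityMeasure_map (by fun_prop)

lemma fst_jointLaw (γ : ℝ) : (X.jointLaw γ).fst = X.inputLaw := by
  rw [jointLaw, Measure.fst, Measure.map_map (by fun_prop) (by fun_prop)]
  exact Measure.fst_prod

lemma lintegral_snd_jointLaw (γ : ℝ) {g : ℂ → ℝ≥0∞} (hg : Measurable g) :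
    ∫⁻ y, g y ∂(X.jointLaw γ).snd = (M : ℝ≥0∞)⁻¹ * ∑ m, ∫⁻ y,
      ENNReal.ofReal (gaussianLikelihood (√γ * X.point m) y) * g y ∂stdComplexGaussian := by
  rw [Measure.snd, lintegral_map hg measurable_snd, 
    lintegral_jointLaw X γ (g := fun p => g p.2) (hg.comp measurable_snd)]
  congr 1
  refine Finset.sum_congr rfl fun m _ => ?_
  rw [← lintegral_map (f := g) hg (by fun_prop), map_const_add_stdComplexGaussian,
    lintegral_withDensity_eq_lintegral_mul _ (by fun_prop) hg]
  rfl

/-- The density of the joint law of input and output relative to the product of its marginals. -/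
noncomputable def informationDensity (γ : ℝ) (p : ℂ × ℂ) : ℝ :=
  M * (gaussianLikelihood (√γ * p.1) p.2 / ∑ m', gaussianLikelihood (√γ * X.point m') p.2)

lemma measurable_informationDensity (γ : ℝ) : Measurable (X.informationDensity γ) := by
  refine ((measurable_gaussianLikelihood.comp
    (by fun_prop : Measurable fun p : ℂ × ℂ => ((√γ : ℂ) * p.1, p.2))).div
    (Finset.measurable_sum _ fun m _ => measurable_gaussianLikelihood.comp
      (by fun_prop : Measurable fun p : ℂ × ℂ => ((√γ : ℂ) * X.point m, p.2)))).const_mul _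

/-- Relative to `CN(0, 1)`, the output has density `M⁻¹ ∑ₘ L_m` and, given `X = x_m`, density
`L_m`, where `L_m` is the likelihood of `x_m`; the information density is their quotient. -/
lemma jointLaw_eq_withDensity (γ : ℝ) :
    X.jointLaw γ = ((X.jointLaw γ).fst.prod (X.jointLaw γ).snd).withDensity
      (fun p => ENNReal.ofReal (X.informationDensity γ p)) := by
  refine Measure.ext_of_lintegral _ fun g hg => ?_
  have hf : Measurable (fun p => ENNReal.ofReal (X.informationDensity γ p)) :=
    (X.measurable_informationDensity γ).ennreal_ofReal
  rw [lintegral_withDensity_eq_lintegral_mul _ hf hg, fst_jointLaw,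
    lintegral_inputLaw_prod X _ (hf.mul hg), lintegral_jointLaw X γ hg]
  congr 1
  refine Finset.sum_congr rfl fun m _ => ?_
  have hgm : Measurable (fun y => g (X.point m, y)) := hg.comp measurable_prodMk_left
  have hl : ∀ a, Measurable (gaussianLikelihood a) := fun a =>
    measurable_gaussianLikelihood.comp measurable_prodMk_left
  have hp : ∀ i, Measurable (fun y => ENNReal.ofReal (gaussianLikelihood (√γ * X.point i) y) *
      ((fun p => ENNReal.ofReal (X.informationDensity γ p)) * g) (X.point m, y)) := fun i =>
    (hl _).ennreal_ofReal.mul ((hf.mul hg).comp measurable_prodMk_left)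
  rw [lintegral_snd_jointLaw X γ (g := fun y => ((fun p =>
      ENNReal.ofReal (X.informationDensity γ p)) * g) (X.point m, y))
      ((hf.mul hg).comp measurable_prodMk_left),
    ← lintegral_map (f := fun y => g (X.point m, y)) hgm (by fun_prop),
    map_const_add_stdComplexGaussian,
    lintegral_withDensity_eq_lintegral_mul _ (by fun_prop) hgm,
    ← lintegral_finsetSum _ (fun i _ => hp i),
    ← lintegral_const_mul _ (Finset.measurable_sum _ fun i _ => hp i)]
  refine lintegral_congr fun y => ?_
  simp only [Pi.mul_apply]
  rw [← Finset.sum_mul, ← ENNReal.ofReal_sum_of_nonneg fun i _ => (gaussianLikelihood_pos _ _).le,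
    ← mul_assoc, ← mul_assoc]
  congr 1
  have hM : (M : ℝ≥0∞)⁻¹ = ENNReal.ofReal ((M : ℝ)⁻¹) := by
    rw [ENNReal.ofReal_inv_of_pos X.card_pos, ENNReal.ofReal_natCast]
  have hS := X.sum_gaussianLikelihood_pos (√γ) y
  have hMp := X.card_pos
  rw [hM, ← ENNReal.ofReal_mul (by positivity), ← ENNReal.ofReal_mul (by positivity)]
  congr 1
  rw [informationDensity]
  field_simp
  rfl

lemma integral_jointLaw (γ : ℝ) {g : ℂ × ℂ → ℝ} (hg : Measurable g)
    (hi : ∀ m, Integrable (fun n => g (X.point m, (√γ : ℂ) * X.point m + n)) stdComplexGaussian) :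
    ∫ p, g p ∂(X.jointLaw γ) = (M : ℝ)⁻¹ *
      ∑ m, ∫ n, g (X.point m, (√γ : ℂ) * X.point m + n) ∂stdComplexGaussian := by
  have hm : ∀ m, Measurable (fun n : ℂ => (X.point m, (√γ : ℂ) * X.point m + n)) := fun m => by
    fun_prop
  have h : X.jointLaw γ = (M : ℝ≥0∞)⁻¹ • ∑ m, stdComplexGaussian.map
      (fun n => (X.point m, (√γ : ℂ) * X.point m + n)) := by
    refine Measure.ext_of_lintegral _ fun g hg => ?_
    rw [lintegral_jointLaw X γ hg, lintegral_smul_measure, lintegral_finsetSum_measure, smul_eq_mul]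
    simp_rw [lintegral_map hg (hm _)]
  rw [h, integral_smul_measure, integral_finsetSum_measure fun m _ =>
    (integrable_map_measure hg.aestronglyMeasurable (hm m).aemeasurable).2 (hi m)]
  simp [integral_map (hm _).aemeasurable hg.aestronglyMeasurable]

lemma mutualInfo_eq (γ : ℝ) :
    X.mutualInfo γ = (Real.log M - X.equivocation √γ) / Real.log 2 := by
  have hf : Measurable (fun p => ENNReal.ofReal (X.informationDensity γ p)) :=
    (X.measurable_informationDensity γ).ennreal_ofReal
  have hac : X.jointLaw γ ≪ (X.jointLaw γ).fst.prod (X.jointLaw γ).snd := by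
    conv_lhs => rw [X.jointLaw_eq_withDensity γ]
    exact withDensity_absolutelyContinuous _ _
  have hr : llr (X.jointLaw γ) ((X.jointLaw γ).fst.prod (X.jointLaw γ).snd) =ᵐ[X.jointLaw γ]
      fun p => Real.log (ENNReal.ofReal (X.informationDensity γ p)).toReal := by
    have h := Measure.rnDeriv_withDensity ((X.jointLaw γ).fst.prod (X.jointLaw γ).snd) hf
    rw [← X.jointLaw_eq_withDensity γ] at h
    filter_upwards [hac.ae_le h] with p hp
    rw [llr, hp]
  have hval : ∀ m n, Real.log (ENNReal.ofReal (X.informationDensity γ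
      (X.point m, (√γ : ℂ) * X.point m + n))).toReal =
      Real.log M - X.posteriorInfo √γ m (√γ * X.point m + n) := by
    intro m n
    have h := exp_neg_posteriorInfo X √γ m (√γ * X.point m + n)
    rw [informationDensity, ← h, ENNReal.toReal_ofReal (by positivity),
      Real.log_mul X.card_pos.ne' (Real.exp_pos _).ne', Real.log_exp, sub_eq_add_neg]
  have hi := fun m => X.integrable_posteriorInfo_add √γ m
  rw [mutualInfo, mutualInfoBits, InformationTheory.toReal_klDiv_of_measure_eq hac (by simp),
    integral_congr_ae hr, integral_jointLaw X γ hf.ennreal_toReal.log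
      (fun m => ((integrable_const _).sub (hi m)).congr (.of_forall fun n => (hval m n).symm))]
  simp_rw [hval]
  congr 1
  rw [Finset.sum_congr rfl fun m _ => integral_sub (integrable_const _) (hi m)]
  have := X.card_pos.ne'
  rw [Finset.sum_sub_distrib, mul_sub, equivocation]
  simp
  field_simp

/-! ### Monotonicity of the equivocation -/

/-- Gibbs' inequality: the posterior information has the least expectation among all
codelengths `q · y` with `∑ₘ exp (-q m y) = 1`. -/
lemma equivocation_le_of_sum_exp_neg (s : ℝ) (q : Fin M → ℂ → ℝ)
    (hq : ∀ y, ∑ m, Real.exp (-q m y) = 1)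
    (hi : ∀ m, Integrable (fun n => q m (s * X.point m + n)) stdComplexGaussian) :
    X.equivocation s ≤
      (M : ℝ)⁻¹ * ∑ m, ∫ n, q m (s * X.point m + n) ∂stdComplexGaussian := by
  refine mul_le_mul_of_nonneg_left ?_ (inv_pos.2 X.card_pos).le
  have hi' := fun m => (integrable_const_add_stdComplexGaussian_iff _ _).1 (hi m)
  have hp' := fun m => (integrable_const_add_stdComplexGaussian_iff _ _).1
    (X.integrable_posteriorInfo_add s m)
  simp_rw [integral_const_add_stdComplexGaussian]
  rw [← integral_finsetSum _ fun m _ => hi' m, ← integral_finsetSum _ fun m _ => hp' m]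
  refine integral_mono (integrable_finsetSum _ fun m _ => hp' m)
    (integrable_finsetSum _ fun m _ => hi' m) fun y => ?_
  have hS := X.sum_gaussianLikelihood_pos s y
  have hw : ∀ m, Real.exp (2 * (star ((s : ℂ) * X.point m) * y).re - ‖(s : ℂ) * X.point m‖ ^ 2) =
      (∑ m', gaussianLikelihood (s * X.point m') y) * Real.exp (-X.posteriorInfo s m y) := by
    intro m
    rw [exp_neg_posteriorInfo, mul_div_cancel₀ _ hS.ne']
    rfl
  simp only [hw, mul_assoc, ← Finset.mul_sum]
  refine mul_le_mul_of_nonneg_left ?_ hS.le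
  have hpt : ∀ m, Real.exp (-X.posteriorInfo s m y) - Real.exp (-q m y) ≤
      Real.exp (-X.posteriorInfo s m y) * q m y -
        Real.exp (-X.posteriorInfo s m y) * X.posteriorInfo s m y := by
    intro m
    have h1 := Real.add_one_le_exp (X.posteriorInfo s m y - q m y)
    have h2 : Real.exp (-q m y) =
        Real.exp (-X.posteriorInfo s m y) * Real.exp (X.posteriorInfo s m y - q m y) := by
      rw [← Real.exp_add]
      congr 1
      ring
    nlinarith [Real.exp_pos (-X.posteriorInfo s m y)]
  have h := Finset.sum_le_sum fun m (_ : m ∈ Finset.univ) => hpt m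
  rw [Finset.sum_sub_distrib, Finset.sum_sub_distrib, hq, X.sum_exp_neg_posteriorInfo] at h
  linarith

/-- The output at the smaller amplitude `s` is a degraded version `a Y + b N'` of the output `Y` at
the larger amplitude `t`, so it carries no more information on the symbol. -/
lemma equivocation_anti {s t : ℝ} (hs : 0 ≤ s) (hst : s ≤ t) :
    X.equivocation t ≤ X.equivocation s := by
  rcases hst.eq_or_lt with rfl | hlt
  · exact le_rfl
  have ht : 0 < t := hs.trans_lt hlt
  set a := s / t with ha
  set b := √(1 - a ^ 2) with hb
  have ha0 : 0 ≤ a := div_nonneg hs ht.le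
  have ha1 : a ≤ 1 := (div_le_one ht).2 hst
  have hat : a * t = s := div_mul_cancel₀ _ ht.ne'
  have hab : a ^ 2 + b ^ 2 = 1 := by
    rw [hb, Real.sq_sqrt (by nlinarith)]
    ring
  set G : Fin M → ℂ → ℝ := fun m n => X.posteriorInfo s m (s * X.point m + n) with hG
  have hφ : Measurable (fun p : ℂ × ℂ => (a : ℂ) * p.1 + (b : ℂ) * p.2) := by fun_prop
  have hGm : ∀ m, Measurable (G m) := fun m =>
    (X.measurable_posteriorInfo s m).comp (by fun_prop)
  have hGi : ∀ m, Integrable (fun p : ℂ × ℂ => G m ((a : ℂ) * p.1 + (b : ℂ) * p.2))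
      (stdComplexGaussian.prod stdComplexGaussian) := fun m => by
    refine (integrable_map_measure (hGm m).aestronglyMeasurable hφ.aemeasurable).1 ?_
    rw [map_add_prod_stdComplexGaussian a b hab]
    exact X.integrable_posteriorInfo_add s m
  have hval : ∀ m, ∫ n, G m n ∂stdComplexGaussian = ∫ w, ∫ n,
      G m ((a : ℂ) * n + (b : ℂ) * w) ∂stdComplexGaussian ∂stdComplexGaussian := fun m => by
    rw [← integral_prod_symm _ (hGi m)]
    conv_lhs => rw [← map_add_prod_stdComplexGaussian a b hab]
    exact integral_map hφ.aemeasurable (hGm m).aestronglyMeasurable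
  have hpt : ∀ᵐ w ∂stdComplexGaussian, X.equivocation t ≤
      (M : ℝ)⁻¹ * ∑ m, ∫ n, G m ((a : ℂ) * n + (b : ℂ) * w) ∂stdComplexGaussian := by
    -- Gibbs' inequality at amplitude `t`, with the posterior at amplitude `s` of `a y + b w`
    -- as codelength; here `w` is a fixed value of the additional noise.
    filter_upwards [ae_all_iff.2 fun m => (hGi m).prod_left_ae] with w hw
    have hshift : ∀ m n, X.posteriorInfo s m ((a : ℂ) * ((t : ℂ) * X.point m + n) + (b : ℂ) * w) =
        G m ((a : ℂ) * n + (b : ℂ) * w) := fun m n => by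
      rw [hG, ← hat]
      congr 1
      push_cast
      ring
    have h := X.equivocation_le_of_sum_exp_neg t
      (fun m y => X.posteriorInfo s m ((a : ℂ) * y + (b : ℂ) * w))
      (fun y => X.sum_exp_neg_posteriorInfo s _)
      (fun m => by simpa only [hshift] using hw m)
    simpa only [hshift] using h
  calc X.equivocation t = ∫ _, X.equivocation t ∂stdComplexGaussian := by simp
    _ ≤ ∫ w, (M : ℝ)⁻¹ * ∑ m, ∫ n, G m ((a : ℂ) * n + (b : ℂ) * w) ∂stdComplexGaussian
          ∂stdComplexGaussian :=
        integral_mono_ae (integrable_const _) ((integrable_finsetSum _ fun m _ =>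
          (hGi m).integral_prod_right).const_mul _) hpt
    _ = X.equivocation s := by
        rw [integral_const_mul, integral_finsetSum _ fun m _ => (hGi m).integral_prod_right,
          equivocation]
        simp_rw [← hval]
        rfl

/-! ### Differentiability of the equivocation -/

/-- Differentiation under the expectation. The derivative of the logarithm of a sum of exponentials
is a convex combination of the derivatives of the exponents, which are affine in the noise. -/
lemma differentiable_equivocation : Differentiable ℝ X.equivocation := by
  intro s₀
  have hne : Nonempty (Fin M) := ⟨⟨0, by have := X.two_le_card; omega⟩⟩
  refine DifferentiableAt.const_mul (DifferentiableAt.fun_sum fun m _ => ?_) _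
  set d : Fin M → ℂ := fun m' => X.point m - X.point m' with hd
  set e : ℝ → ℂ → Fin M → ℝ := fun s n m' =>
    Real.exp (-(s ^ 2 * ‖d m'‖ ^ 2) - 2 * s * (star (d m') * n).re) with he
  set e' : ℝ → ℂ → Fin M → ℝ := fun s n m' =>
    -(2 * s * ‖d m'‖ ^ 2) - 2 * (star (d m') * n).re with he'
  have hpos : ∀ s n, 0 < ∑ m', e s n m' := fun s n =>
    Finset.sum_pos (fun _ _ => Real.exp_pos _) Finset.univ_nonempty
  have hder : ∀ s n, HasDerivAt (fun s => Real.log (∑ m', e s n m'))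
      ((∑ m', e s n m' * e' s n m') / ∑ m', e s n m') s := fun s n => by
    refine HasDerivAt.log (HasDerivAt.fun_sum fun m' _ => ?_) (hpos s n).ne'
    refine HasDerivAt.exp ?_
    have h1 := (((hasDerivAt_pow 2 s).mul_const (‖d m'‖ ^ 2)).fun_neg.sub
      (((hasDerivAt_id s).const_mul 2).mul_const (star (d m') * n).re))
    refine h1.congr_deriv ?_
    simp [he']
  have hbound : ∀ n, ∀ s ∈ Metric.ball s₀ 1,
      ‖(∑ m', e s n m' * e' s n m') / ∑ m', e s n m'‖ ≤
        ∑ m', (2 * (|s₀| + 1) * ‖d m'‖ ^ 2 + |2 * (star (d m') * n).re|) := by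
    intro n s hs
    have hs1 : |s| ≤ |s₀| + 1 := by
      have h := abs_sub_abs_le_abs_sub s s₀
      rw [Metric.mem_ball, Real.dist_eq] at hs
      linarith
    rw [norm_div, Real.norm_of_nonneg (hpos s n).le, div_le_iff₀ (hpos s n), Finset.sum_mul]
    refine (norm_sum_le _ _).trans (Finset.sum_le_sum fun m' _ => ?_)
    rw [norm_mul, mul_comm, Real.norm_of_nonneg (Real.exp_pos _).le]
    refine mul_le_mul ?_ (Finset.single_le_sum (f := e s n) (fun _ _ => (Real.exp_pos _).le)
      (Finset.mem_univ m')) (Real.exp_pos _).le (by positivity)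
    refine (norm_sub_le _ _).trans (add_le_add ?_ le_rfl)
    rw [norm_neg, norm_mul, norm_mul, Real.norm_eq_abs s, Real.norm_of_nonneg (sq_nonneg ‖d m'‖)]
    simp only [Real.norm_ofNat]
    gcongr
  have hmeas : ∀ s, Measurable (fun n => (∑ m', e s n m' * e' s n m') / ∑ m', e s n m') :=
    fun s => by fun_prop
  have hmain := hasDerivAt_integral_of_dominated_loc_of_deriv_le (μ := stdComplexGaussian)
    (F := fun s n => Real.log (∑ m', e s n m'))
    (F' := fun s n => (∑ m', e s n m' * e' s n m') / ∑ m', e s n m')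
    (bound := fun n => ∑ m', (2 * (|s₀| + 1) * ‖d m'‖ ^ 2 + |2 * (star (d m') * n).re|))
    (Metric.ball_mem_nhds s₀ one_pos)
    (.of_forall fun s => (by fun_prop : Measurable _).aestronglyMeasurable)
    ((X.integrable_posteriorInfo_add s₀ m).congr
      (.of_forall fun n => X.posteriorInfo_add s₀ m n))
    (hmeas s₀).aestronglyMeasurable (.of_forall hbound)
    (integrable_finsetSum _ fun m' _ =>
      (integrable_const _).add (integrable_abs_re_stdComplexGaussian _))
    (.of_forall fun n s _ => hder s n)
  simp_rw [posteriorInfo_add]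
  exact hmain.2.differentiableAt

/-! ### Equivocation as a function of the signal-to-noise ratio -/

/-- The equivocation (in bits) `log₂ M - I(γ)` at signal-to-noise ratio `γ`. -/
noncomputable def rateLoss (γ : ℝ) : ℝ := X.equivocation √γ / Real.log 2

lemma mutualInfo_eq_sub_rateLoss (γ : ℝ) :
    X.mutualInfo γ = Real.logb 2 M - X.rateLoss γ := by
  rw [mutualInfo_eq, sub_div, rateLoss, Real.logb]

lemma rateLoss_pos (γ : ℝ) : 0 < X.rateLoss γ :=
  div_pos (X.equivocation_pos _) (Real.log_pos one_lt_two)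

lemma antitone_rateLoss : Antitone X.rateLoss := fun _ _ h =>
  div_le_div_of_nonneg_right (X.equivocation_anti (Real.sqrt_nonneg _) (Real.sqrt_le_sqrt h))
    (Real.log_pos one_lt_two).le

lemma monotone_mutualInfo : Monotone X.mutualInfo := fun a b h => by
  rw [mutualInfo_eq_sub_rateLoss, mutualInfo_eq_sub_rateLoss]
  exact sub_le_sub_left (X.antitone_rateLoss h) _

lemma continuous_rateLoss : Continuous X.rateLoss :=
  (X.differentiable_equivocation.continuous.comp Real.continuous_sqrt).div_const _

lemma differentiableAt_rateLoss {γ : ℝ} (hγ : 0 < γ) : DifferentiableAt ℝ X.rateLoss γ :=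
  ((X.differentiable_equivocation _).comp γ (Real.hasDerivAt_sqrt hγ.ne').differentiableAt).div_const
    _

/-- The exponential majorant of the rate loss coming from `equivocation_le`. -/
noncomputable def rateLossBound (γ : ℝ) : ℝ :=
  (M : ℝ)⁻¹ * (∑ m, 2 * ∑ m' ∈ Finset.univ.erase m,
    Real.exp (-(‖X.point m - X.point m'‖ ^ 2 / 4) * γ)) / Real.log 2

lemma rateLoss_le {γ : ℝ} (hγ : 0 ≤ γ) : X.rateLoss γ ≤ X.rateLossBound γ := by
  refine div_le_div_of_nonneg_right ?_ (Real.log_pos one_lt_two).le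
  have h := X.equivocation_le √γ
  rw [Real.sq_sqrt hγ] at h
  simpa only [neg_mul] using h

lemma sq_dist_div_four_pos {m m' : Fin M} (h : m' ∈ Finset.univ.erase m) :
    0 < ‖X.point m - X.point m'‖ ^ 2 / 4 := by
  have h1 : X.point m - X.point m' ≠ 0 :=
    sub_ne_zero.2 fun h2 => (Finset.ne_of_mem_erase h) (X.injective h2).symm
  have := norm_pos_iff.2 h1
  positivity

lemma integrableOn_rateLoss : IntegrableOn X.rateLoss (Set.Ioi 0) := by
  have h : IntegrableOn X.rateLossBound (Set.Ioi 0) :=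
    Integrable.div_const (Integrable.const_mul (integrable_finsetSum _ fun m _ =>
      (integrable_finsetSum _ fun m' hm' =>
        exp_neg_integrableOn_Ioi 0 (X.sq_dist_div_four_pos hm')).const_mul _) _) _
  refine Integrable.mono' h X.continuous_rateLoss.aestronglyMeasurable ?_
  filter_upwards [ae_restrict_mem measurableSet_Ioi] with γ hγ
  rw [Real.norm_of_nonneg (X.rateLoss_pos γ).le]
  exact X.rateLoss_le (le_of_lt hγ)

lemma tendsto_mul_rateLoss : Tendsto (fun γ => γ * X.rateLoss γ) atTop (nhds 0) := by
  have h : Tendsto (fun γ => γ * X.rateLossBound γ) atTop (nhds 0) := by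
    have h1 : Tendsto (fun γ : ℝ => (M : ℝ)⁻¹ * (∑ m, 2 * ∑ m' ∈ Finset.univ.erase m,
        γ ^ (1 : ℝ) * Real.exp (-(‖X.point m - X.point m'‖ ^ 2 / 4) * γ)) / Real.log 2) atTop
        (nhds ((M : ℝ)⁻¹ * (∑ m : Fin M, 2 * ∑ m' ∈ Finset.univ.erase m, 0) / Real.log 2)) :=
      ((tendsto_finsetSum _ fun m _ => (tendsto_finsetSum _ fun m' hm' =>
        tendsto_rpow_mul_exp_neg_mul_atTop_nhds_zero 1 _
          (X.sq_dist_div_four_pos hm')).const_mul _).const_mul _).div_const _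
    simp only [Finset.sum_const_zero, mul_zero, zero_div] at h1
    refine h1.congr fun γ => ?_
    simp only [Real.rpow_one, ← Finset.mul_sum, rateLossBound]
    ring
  refine squeeze_zero' ?_ ?_ h
  · filter_upwards [eventually_ge_atTop 0] with γ hγ
    exact mul_nonneg hγ (X.rateLoss_pos γ).le
  · filter_upwards [eventually_ge_atTop 0] with γ hγ
    exact mul_le_mul_of_nonneg_left (X.rateLoss_le hγ) hγ

lemma differentiableAt_mutualInfo {γ : ℝ} (hγ : 0 < γ) : DifferentiableAt ℝ X.mutualInfo γ := by
  rw [funext X.mutualInfo_eq_sub_rateLoss]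
  exact (X.differentiableAt_rateLoss hγ).const_sub _

lemma mmse_eq (γ : ℝ) : X.mmse γ = -deriv X.rateLoss γ := by
  rw [mmse, funext X.mutualInfo_eq_sub_rateLoss, deriv_const_sub]

/-- An antiderivative of `x MMSE(x)`: integration by parts applied to the rate loss. -/
noncomputable def mellinPrimitive (x : ℝ) : ℝ := (∫ u in (0 : ℝ)..x, X.rateLoss u) - x * X.rateLoss x

lemma hasDerivAt_mellinPrimitive {x : ℝ} (hx : 0 < x) :
    HasDerivAt X.mellinPrimitive (x * X.mmse x) x := by
  have h1 := X.continuous_rateLoss.integral_hasStrictDerivAt 0 x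
  refine (h1.hasDerivAt.sub
    ((hasDerivAt_id x).mul (X.differentiableAt_rateLoss hx).hasDerivAt)).congr_deriv ?_
  rw [mmse_eq]
  simp

lemma continuous_mellinPrimitive : Continuous X.mellinPrimitive :=
  (intervalIntegral.continuous_primitive
    (fun _ _ => X.continuous_rateLoss.intervalIntegrable _ _) 0).sub
    (continuous_id.mul X.continuous_rateLoss)

lemma tendsto_mellinPrimitive :
    Tendsto X.mellinPrimitive atTop (nhds (∫ u in Set.Ioi (0 : ℝ), X.rateLoss u)) := by
  have h := (intervalIntegral_tendsto_integral_Ioi 0 X.integrableOn_rateLoss tendsto_id).sub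
    X.tendsto_mul_rateLoss
  rwa [sub_zero] at h

lemma mmse_nonneg (x : ℝ) : 0 ≤ X.mmse x := X.monotone_mutualInfo.deriv_nonneg

lemma integrableOn_mul_mmse : IntegrableOn (fun x => x * X.mmse x) (Set.Ioi 0) :=
  integrableOn_Ioi_deriv_of_nonneg X.continuous_mellinPrimitive.continuousWithinAt
    (fun _ hx => X.hasDerivAt_mellinPrimitive hx)
    (fun _ hx => mul_nonneg (le_of_lt hx) (X.mmse_nonneg _)) X.tendsto_mellinPrimitive

/-- Integration by parts: `∫₀^∞ x I'(x) dx = ∫₀^∞ (log₂ M - I(x)) dx`. -/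
lemma mmseMellinTwo_eq : X.mmseMellinTwo = ∫ u in Set.Ioi (0 : ℝ), X.rateLoss u := by
  have h := integral_Ioi_of_hasDerivAt_of_nonneg
    X.continuous_mellinPrimitive.continuousWithinAt
    (fun _ hx => X.hasDerivAt_mellinPrimitive hx)
    (fun _ hx => mul_nonneg (le_of_lt hx) (X.mmse_nonneg _)) X.tendsto_mellinPrimitive
  rw [mmseMellinTwo, h]
  simp [mellinPrimitive]

lemma mmseMellinTwo_pos : 0 < X.mmseMellinTwo := by
  rw [mmseMellinTwo_eq, integral_pos_iff_support_of_nonneg (fun u => (X.rateLoss_pos u).le)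
    X.integrableOn_rateLoss]
  have : Function.support X.rateLoss = Set.univ :=
    Set.eq_univ_of_forall fun u => (X.rateLoss_pos u).ne'
  simp [this]

end Constellation

/-! ### Law of the smallest beamforming gain -/

lemma sum_norm_sq_vecMul_sqrt {N : ℕ} {R : Matrix (Fin N) (Fin N) ℂ} (hR : R.PosSemidef)
    (f : Fin N → ℂ) : ∑ i, ‖(star f ᵥ* CFC.sqrt R) i‖ ^ 2 = beamGain R f := by
  have hS : (CFC.sqrt R)ᴴ = CFC.sqrt R := (Matrix.nonneg_iff_posSemidef.1 (CFC.sqrt_nonneg R)).1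
  have hSS : CFC.sqrt R * CFC.sqrt R = R := CFC.sqrt_mul_sqrt_self R hR.nonneg
  have h : (star f ᵥ* CFC.sqrt R) ⬝ᵥ star (star f ᵥ* CFC.sqrt R) = star f ⬝ᵥ (R *ᵥ f) := by
    rw [Matrix.star_vecMul, star_star, hS, ← Matrix.dotProduct_mulVec, Matrix.mulVec_mulVec, hSS]
  rw [beamGain, ← h, dotProduct, Complex.re_sum]
  refine Finset.sum_congr rfl fun i _ => ?_
  rw [Pi.star_apply, Complex.star_def, Complex.mul_conj, Complex.ofReal_re,
    Complex.normSq_eq_norm_sq]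

/-- The gain `|hᴴ f|²` of a channel `h ∼ CN(0, R)` is exponential with mean `fᴴ R f`. -/
lemma complexGaussianVector_gain_gt {N : ℕ} {R : Matrix (Fin N) (Fin N) ℂ} (hR : R.PosSemidef)
    {f : Fin N → ℂ} (hf : 0 < beamGain R f) {t : ℝ} (ht : 0 ≤ t) :
    complexGaussianVector R {h | t < ‖star h ⬝ᵥ f‖ ^ 2} =
      ENNReal.ofReal (Real.exp (-(1 / beamGain R f * t))) := by
  have hmul : Measurable (fun g : Fin N → ℂ => CFC.sqrt R *ᵥ g) :=
    (by fun_prop : Continuous fun g : Fin N → ℂ => CFC.sqrt R *ᵥ g).measurable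
  have hnorm : Measurable (fun h : Fin N → ℂ => ‖star h ⬝ᵥ f‖ ^ 2) :=
    (by unfold dotProduct; fun_prop : Continuous fun h : Fin N → ℂ => ‖star h ⬝ᵥ f‖ ^ 2).measurable
  have hlin : Measurable (fun g : Fin N → ℂ => ∑ i, (star f ᵥ* CFC.sqrt R) i * g i) :=
    (by fun_prop : Continuous fun g : Fin N → ℂ =>
      ∑ i, (star f ᵥ* CFC.sqrt R) i * g i).measurable
  have hset : MeasurableSet {z : ℂ | t < ‖z‖ ^ 2} :=
    measurableSet_lt measurable_const (by fun_prop)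
  have hpre : (fun g : Fin N → ℂ => CFC.sqrt R *ᵥ g) ⁻¹' {h | t < ‖star h ⬝ᵥ f‖ ^ 2} =
      (fun g : Fin N → ℂ => ∑ i, (star f ᵥ* CFC.sqrt R) i * g i) ⁻¹' {z : ℂ | t < ‖z‖ ^ 2} := by
    ext g
    have h1 : star (star (CFC.sqrt R *ᵥ g) ⬝ᵥ f) = ∑ i, (star f ᵥ* CFC.sqrt R) i * g i := by
      rw [← Matrix.star_dotProduct_star, star_star, Matrix.dotProduct_mulVec]
      rfl
    simp only [Set.mem_preimage, Set.mem_ofPred_eq, ← h1, norm_star]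
  rw [complexGaussianVector, Measure.map_apply hmul (measurableSet_lt measurable_const hnorm), hpre,
    ← Measure.map_apply hlin hset, map_sum_mul_pi_stdComplexGaussian,
    Measure.map_apply (by fun_prop) hset, sum_norm_sq_vecMul_sqrt hR]
  have hpre2 : (fun z : ℂ => (√(beamGain R f) : ℂ) * z) ⁻¹' {z : ℂ | t < ‖z‖ ^ 2} =
      {z : ℂ | 1 / beamGain R f * t < ‖z‖ ^ 2} := by
    ext z
    simp only [Set.mem_preimage, Set.mem_ofPred_eq, norm_mul, mul_pow, Complex.norm_real,
      Real.norm_eq_abs, sq_abs, Real.sq_sqrt hf.le]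
    rw [one_div_mul_eq_div, div_lt_iff₀' hf]
  rw [hpre2, stdComplexGaussian_norm_sq_gt (by positivity)]

lemma lt_ciInf_iff_of_finite {ι : Type*} [Finite ι] [Nonempty ι] (u : ι → ℝ) (t : ℝ) :
    t < ⨅ i, u i ↔ ∀ i, t < u i := by
  refine ⟨fun h i => h.trans_le (ciInf_le (Set.finite_range u).bddBelow i), fun h => ?_⟩
  obtain ⟨i, hi⟩ := exists_eq_ciInf_of_finite (f := u)
  rw [← hi]
  exact h i

/-- A nonnegative random variable with exponential tail has the exponential law. -/
lemma map_eq_expMeasure {Ω : Type*} [MeasurableSpace Ω] {P : Measure Ω} [IsProbabilityMeasure P]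
    {Z : Ω → ℝ} (hZ : AEMeasurable Z P) {r : ℝ} (hr : 0 < r) (h0 : ∀ ω, 0 ≤ Z ω)
    (htail : ∀ t, 0 ≤ t → P {ω | t < Z ω} = ENNReal.ofReal (Real.exp (-(r * t)))) :
    P.map Z = expMeasure r := by
  have := isProbabilityMeasure_expMeasure hr
  have := Measure.isProbabilityMeasure_map hZ
  refine Measure.eq_of_cdf _ _ (StieltjesFunction.ext fun x => ?_)
  rw [cdf_expMeasure_eq hr, cdf_eq_real, measureReal_def,
    Measure.map_apply_of_aemeasurable hZ measurableSet_Iic]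
  split_ifs with hx
  · have hc : Z ⁻¹' Set.Iic x = {ω | x < Z ω}ᶜ := by
      ext ω
      simp
    rw [hc, prob_compl_eq_one_sub₀ (nullMeasurableSet_lt aemeasurable_const hZ), htail x hx,
      ENNReal.toReal_sub_of_le (by
        rw [ENNReal.ofReal_le_one, Real.exp_le_one_iff]
        have := mul_nonneg hr.le hx
        linarith) (by simp), ENNReal.toReal_one,
      ENNReal.toReal_ofReal (Real.exp_pos _).le]
  · have hc : Z ⁻¹' Set.Iic x = ∅ := by
      ext ω
      simpa using (not_le.1 hx).trans_le (h0 ω)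
    simp [hc]

lemma integral_expMeasure {r : ℝ} (hr : 0 < r) (g : ℝ → ℝ) :
    ∫ z, g z ∂expMeasure r = ∫ z in Set.Ioi 0, r * Real.exp (-(r * z)) * g z := by
  have h : expMeasure r = volume.withDensity (exponentialPDF r) := rfl
  have hm : Measurable (exponentialPDF r) := (measurable_exponentialPDFReal r).ennreal_ofReal
  rw [h, integral_withDensity_eq_integral_toReal_smul hm (by simp [exponentialPDF]),
    ← integral_Ici_eq_integral_Ioi, ← integral_indicator measurableSet_Ici]
  refine integral_congr_ae (.of_forall fun z => ?_)
  simp only [exponentialPDF_eq, Set.indicator, Set.mem_Ici]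
  split_ifs with hz
  · rw [ENNReal.toReal_ofReal (by positivity), smul_eq_mul]
  · simp

/-- The smallest of the independent gains `|h_kᴴ f|²`, exponential with means `fᴴ R_k f`, is
exponential with rate `∑ₖ 1 / fᴴ R_k f`. -/
lemma map_iInf_gain {N K : ℕ} (hK : 0 < K) {R : Fin K → Matrix (Fin N) (Fin N) ℂ}
    (hR : ∀ k, (R k).PosSemidef) {f : Fin N → ℂ} (hf : ∀ k, 0 < beamGain (R k) f)
    {Ω : Type*} [MeasurableSpace Ω] {P : Measure Ω} [IsProbabilityMeasure P]
    {h : Fin K → Ω → Fin N → ℂ} (hlaw : ∀ k, HasLaw (h k) (complexGaussianVector (R k)) P)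
    (hindep : iIndepFun h P) :
    AEMeasurable (fun ω => ⨅ k, ‖star (h k ω) ⬝ᵥ f‖ ^ 2) P ∧
      P.map (fun ω => ⨅ k, ‖star (h k ω) ⬝ᵥ f‖ ^ 2) =
        expMeasure (∑ k, 1 / beamGain (R k) f) := by
  have hne : Nonempty (Fin K) := ⟨⟨0, hK⟩⟩
  have hnorm : Measurable (fun h : Fin N → ℂ => ‖star h ⬝ᵥ f‖ ^ 2) :=
    (by unfold dotProduct; fun_prop : Continuous fun h : Fin N → ℂ => ‖star h ⬝ᵥ f‖ ^ 2).measurable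
  have hZ : AEMeasurable (fun ω => ⨅ k, ‖star (h k ω) ⬝ᵥ f‖ ^ 2) P :=
    AEMeasurable.iInf fun k => hnorm.comp_aemeasurable (hlaw k).aemeasurable
  refine ⟨hZ, map_eq_expMeasure hZ
    (Finset.sum_pos (fun k _ => one_div_pos.2 (hf k)) Finset.univ_nonempty)
    (fun ω => Real.iInf_nonneg fun k => by positivity) fun t ht => ?_⟩
  have hset : MeasurableSet {v : Fin N → ℂ | t < ‖star v ⬝ᵥ f‖ ^ 2} :=
    measurableSet_lt measurable_const hnorm
  have h1 : {ω | t < ⨅ k, ‖star (h k ω) ⬝ᵥ f‖ ^ 2} =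
      ⋂ k ∈ (Finset.univ : Finset (Fin K)), h k ⁻¹' {v | t < ‖star v ⬝ᵥ f‖ ^ 2} := by
    ext ω
    simp [lt_ciInf_iff_of_finite]
  rw [h1, hindep.measure_inter_preimage_eq_mul _ fun k _ => hset, Finset.sum_mul,
    ← Finset.sum_neg_distrib, Real.exp_sum, ENNReal.ofReal_prod_of_nonneg
      fun k _ => (Real.exp_pos _).le]
  refine Finset.prod_congr rfl fun k _ => ?_
  rw [← complexGaussianVector_gain_gt (hR k) (hf k) ht, ← (hlaw k).measure_eq hset]
  rfl

/-! ### High-SNR behaviour of the average multicast rate -/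

lemma receivedSNR_iInf {N K : ℕ} {γbar : ℝ} (hγ : 0 < γbar) (f : Fin N → ℂ)
    (h : Fin K → Fin N → ℂ) :
    ⨅ k, receivedSNR γbar f (h k) = γbar * ⨅ k, ‖star (h k) ⬝ᵥ f‖ ^ 2 := by
  simp only [receivedSNR, Real.mul_iInf_of_nonneg hγ.le]

lemma multicastRate_eq {M N K : ℕ} (hK : 0 < K) (X : Constellation M) (γbar : ℝ)
    (f : Fin N → ℂ) (h : Fin K → Fin N → ℂ) :
    multicastRate X γbar f h = X.mutualInfo (⨅ k, receivedSNR γbar f (h k)) := by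
  have hne : Nonempty (Fin K) := ⟨⟨0, hK⟩⟩
  refine le_antisymm ?_ (le_ciInf fun k =>
    X.monotone_mutualInfo (ciInf_le (Set.finite_range _).bddBelow k))
  obtain ⟨k, hk⟩ := exists_eq_ciInf_of_finite (f := fun k => receivedSNR γbar f (h k))
  rw [← hk]
  exact ciInf_le (f := fun k => X.mutualInfo (receivedSNR γbar f (h k)))
    (Set.finite_range _).bddBelow k

/-- With the substitution `u = γ z`, the mean rate loss at average SNR `γ` over an exponential gain
of rate `r` is `(r / γ) ∫₀^∞ exp (-r u / γ) L(u) du`. -/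
lemma integral_rateLoss_expMeasure {M : ℕ} (X : Constellation M) {r γ : ℝ} (hr : 0 < r)
    (hγ : 0 < γ) :
    ∫ z, X.rateLoss (γ * z) ∂expMeasure r =
      γ⁻¹ * (r * ∫ u in Set.Ioi 0, Real.exp (-(r * (u / γ))) * X.rateLoss u) := by
  rw [integral_expMeasure hr]
  have h := integral_comp_mul_left_Ioi
    (fun u => r * Real.exp (-(r * (u / γ))) * X.rateLoss u) 0 hγ
  simp only [mul_div_cancel_left₀ _ hγ.ne', mul_zero, smul_eq_mul] at h
  rw [h, ← integral_const_mul r]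
  simp only [mul_assoc]

lemma tendsto_integral_exp_mul_rateLoss {M : ℕ} (X : Constellation M) {r : ℝ} (hr : 0 < r) :
    Tendsto (fun γ : ℝ => ∫ u in Set.Ioi 0, Real.exp (-(r * (u / γ))) * X.rateLoss u) atTop
      (nhds X.mmseMellinTwo) := by
  rw [X.mmseMellinTwo_eq]
  refine tendsto_integral_filter_of_dominated_convergence X.rateLoss ?_ ?_
    X.integrableOn_rateLoss ?_
  · exact .of_forall fun γ => ((by fun_prop : Continuous fun u : ℝ =>
      Real.exp (-(r * (u / γ)))).mul X.continuous_rateLoss).aestronglyMeasurable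
  · filter_upwards [eventually_gt_atTop 0] with γ hγ
    filter_upwards [ae_restrict_mem measurableSet_Ioi] with u hu
    have hu0 : 0 < u := hu
    rw [norm_mul, Real.norm_of_nonneg (Real.exp_pos _).le,
      Real.norm_of_nonneg (X.rateLoss_pos u).le]
    refine mul_le_of_le_one_left (X.rateLoss_pos u).le (Real.exp_le_one_iff.2 ?_)
    have : 0 < r * (u / γ) := by positivity
    linarith
  · refine .of_forall fun u => ?_
    have h1 : Tendsto (fun γ : ℝ => Real.exp (-(r * (u / γ)))) atTop
        (nhds (Real.exp (-(r * 0)))) :=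
      (Real.continuous_exp.tendsto _).comp
        (((tendsto_const_nhds.div_atTop tendsto_id).const_mul r).neg)
    simpa using h1.mul_const (X.rateLoss u)

lemma integrable_multicastRate {M N K : ℕ} (hK : 0 < K) (X : Constellation M)
    {f : Fin N → ℂ} {Ω : Type*} [MeasurableSpace Ω] {P : Measure Ω} [IsProbabilityMeasure P]
    {h : Fin K → Ω → Fin N → ℂ}
    (hZ : AEMeasurable (fun ω => ⨅ k, ‖star (h k ω) ⬝ᵥ f‖ ^ 2) P) {γbar : ℝ} (hγ : 0 < γbar) :
    Integrable (fun ω => multicastRate X γbar f (fun k => h k ω)) P := by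
  have heq : ∀ ω, multicastRate X γbar f (fun k => h k ω) =
      X.mutualInfo (γbar * ⨅ k, ‖star (h k ω) ⬝ᵥ f‖ ^ 2) := fun ω => by
    rw [multicastRate_eq hK, receivedSNR_iInf hγ]
  simp_rw [heq]
  refine Integrable.of_bound (C := |X.mutualInfo 0| + |Real.logb 2 M|)
    (X.monotone_mutualInfo.measurable.comp_aemeasurable (hZ.const_mul γbar)).aestronglyMeasurable
    (.of_forall fun ω => ?_)
  have h0 : 0 ≤ γbar * ⨅ k, ‖star (h k ω) ⬝ᵥ f‖ ^ 2 :=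
    mul_nonneg hγ.le (Real.iInf_nonneg fun k => by positivity)
  have h1 := X.monotone_mutualInfo h0
  have h2 := X.mutualInfo_eq_sub_rateLoss (γbar * ⨅ k, ‖star (h k ω) ⬝ᵥ f‖ ^ 2)
  have h3 := X.rateLoss_pos (γbar * ⨅ k, ‖star (h k ω) ⬝ᵥ f‖ ^ 2)
  rw [Real.norm_eq_abs]
  refine abs_le.2 ⟨?_, ?_⟩
  · linarith [neg_abs_le (X.mutualInfo 0), abs_nonneg (Real.logb 2 M)]
  · linarith [le_abs_self (Real.logb 2 M), abs_nonneg (X.mutualInfo 0)]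

/-- The first-order high-SNR expansion: `γ̄ (log₂ M - AMR(γ̄))` tends to `M[MMSE; 2] ∑ₖ 1 / fᴴ R_k f`.
-/
lemma tendsto_mul_averageMulticastRate {M N K : ℕ} (hK : 0 < K) (X : Constellation M)
    {R : Fin K → Matrix (Fin N) (Fin N) ℂ} (hR : ∀ k, (R k).PosSemidef) {f : Fin N → ℂ}
    (hf : ∀ k, 0 < beamGain (R k) f) {Ω : Type*} [MeasurableSpace Ω] {P : Measure Ω}
    [IsProbabilityMeasure P] {h : Fin K → Ω → Fin N → ℂ}
    (hlaw : ∀ k, HasLaw (h k) (complexGaussianVector (R k)) P) (hindep : iIndepFun h P) :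
    Tendsto (fun γbar : ℝ => γbar * (averageMulticastRate P X γbar f h - Real.logb 2 M)) atTop
      (nhds (-(X.mmseMellinTwo * ∑ k, 1 / beamGain (R k) f))) := by
  have hne : Nonempty (Fin K) := ⟨⟨0, hK⟩⟩
  obtain ⟨hZ, hmap⟩ := map_iInf_gain hK hR hf hlaw hindep
  set r := ∑ k, 1 / beamGain (R k) f with hrdef
  have hr : 0 < r := Finset.sum_pos (fun k _ => one_div_pos.2 (hf k)) Finset.univ_nonempty
  have hlim := ((tendsto_integral_exp_mul_rateLoss X hr).const_mul r).neg
  rw [mul_comm r] at hlim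
  refine hlim.congr' ?_
  filter_upwards [eventually_gt_atTop 0] with γ hγ
  have hint := integrable_multicastRate hK X hZ hγ
  have heq : ∀ ω, multicastRate X γ f (fun k => h k ω) - Real.logb 2 M =
      -X.rateLoss (γ * ⨅ k, ‖star (h k ω) ⬝ᵥ f‖ ^ 2) := fun ω => by
    rw [multicastRate_eq hK, receivedSNR_iInf hγ, X.mutualInfo_eq_sub_rateLoss]
    ring
  have hmean : averageMulticastRate P X γ f h - Real.logb 2 M =
      -∫ z, X.rateLoss (γ * z) ∂expMeasure r := by
    have h1 : Real.logb 2 M = ∫ _, Real.logb 2 M ∂P := by simp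
    rw [averageMulticastRate, h1, ← integral_sub hint (integrable_const _)]
    simp_rw [heq]
    rw [integral_neg, ← hmap]
    exact congrArg _ (integral_map hZ
      (X.continuous_rateLoss.comp (continuous_const_mul γ)).aestronglyMeasurable).symm
  rw [hmean, integral_rateLoss_expMeasure X hr hγ]
  field_simp

/-! ### Diversity order and array gain -/

lemma isLittleO_rpow_neg_iff (u : ℝ → ℝ) (p : ℝ) :
    u =o[atTop] (fun γ : ℝ => γ ^ (-p)) ↔
      Tendsto (fun γ => γ ^ p * u γ) atTop (nhds 0) := by
  rw [isLittleO_iff_tendsto']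
  · refine tendsto_congr' ?_
    filter_upwards [eventually_gt_atTop 0] with γ hγ
    rw [Real.rpow_neg hγ.le, div_inv_eq_mul, mul_comm]
  · filter_upwards [eventually_gt_atTop 0] with γ hγ h
    exact absurd h (Real.rpow_pos_of_pos hγ _).ne'

/-- A nonzero first-order coefficient at infinity determines the diversity order and, together with
its sign, the array gain. -/
lemma hasDiversityOrderAndArrayGain_iff {F : ℝ → ℝ} {A₀ d : ℝ} (hd : 0 < d)
    (hF : Tendsto (fun γ => γ * (F γ - A₀)) atTop (nhds (-(1 / d)))) (Gd Gc : ℝ) :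
    HasDiversityOrderAndArrayGain F Gd Gc ↔ Gd = 1 ∧ Gc = d := by
  constructor
  · rintro ⟨hGd, hGc, A, s, hs, ho⟩
    rw [isLittleO_rpow_neg_iff] at ho
    have hs0 : s ≠ 0 := by rcases hs with rfl | rfl <;> norm_num
    have hc0 : s * Gc ^ (-Gd) ≠ 0 := mul_ne_zero hs0 (Real.rpow_pos_of_pos hGc _).ne'
    have hv0 : -(1 / d) ≠ 0 := neg_ne_zero.2 (one_div_pos.2 hd).ne'
    have hu : Tendsto (fun γ => γ ^ Gd * (F γ - A)) atTop (nhds (s * Gc ^ (-Gd))) := by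
      have h := ho.add_const (s * Gc ^ (-Gd))
      rw [zero_add] at h
      refine h.congr' ?_
      filter_upwards [eventually_gt_atTop 0] with γ hγ
      have h1 : γ ^ Gd * γ ^ (-Gd) = 1 := by rw [← Real.rpow_add hγ]; simp
      rw [Real.mul_rpow hGc.le hγ.le]
      linear_combination (-s * Gc ^ (-Gd)) * h1
    -- Both expansions give the limit of `F` at infinity.
    have hlim1 : Tendsto F atTop (nhds A₀) := by
      have h := (tendsto_inv_atTop_zero.mul hF).add_const A₀
      rw [zero_mul, zero_add] at h
      refine h.congr' ?_
      filter_upwards [eventually_gt_atTop 0] with γ hγ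
      field_simp
      ring
    have hlim2 : Tendsto F atTop (nhds A) := by
      have h := ((tendsto_rpow_neg_atTop hGd).mul hu).add_const A
      rw [zero_mul, zero_add] at h
      refine h.congr' ?_
      filter_upwards [eventually_gt_atTop 0] with γ hγ
      have h1 : γ ^ (-Gd) * γ ^ Gd = 1 := by rw [← Real.rpow_add hγ]; simp
      linear_combination (F γ - A) * h1
    obtain rfl := tendsto_nhds_unique hlim1 hlim2
    have hGd1 : Gd = 1 := by
      rcases lt_trichotomy Gd 1 with hlt | heq | hgt
      · have h := (tendsto_rpow_neg_atTop (sub_pos.2 hlt)).mul hF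
        rw [zero_mul] at h
        refine absurd (tendsto_nhds_unique hu (h.congr' ?_)) hc0
        filter_upwards [eventually_gt_atTop 0] with γ hγ
        rw [← mul_assoc, ← Real.rpow_add_one hγ.ne']
        congr 2
        ring
      · exact heq
      · have h := (tendsto_rpow_neg_atTop (sub_pos.2 hgt)).mul hu
        rw [zero_mul] at h
        refine absurd (tendsto_nhds_unique hF (h.congr' ?_)) hv0
        filter_upwards [eventually_gt_atTop 0] with γ hγ
        rw [← mul_assoc, ← Real.rpow_add hγ]
        simp
    subst hGd1
    simp only [Real.rpow_one, Real.rpow_neg_one] at hu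
    have heq := tendsto_nhds_unique hu hF
    refine ⟨rfl, ?_⟩
    rcases hs with rfl | rfl
    · have h1 := inv_pos.2 hGc
      have h2 := one_div_pos.2 hd
      linarith
    · rw [neg_one_mul, neg_inj, one_div] at heq
      exact inv_injective heq
  · rintro ⟨rfl, rfl⟩
    refine ⟨one_pos, hd, A₀, -1, Or.inr rfl, ?_⟩
    rw [isLittleO_rpow_neg_iff]
    have h := hF.add_const (1 / Gc)
    rw [neg_add_cancel] at h
    refine h.congr' ?_
    filter_upwards [eventually_gt_atTop 0] with γ hγ
    rw [Real.rpow_one, Real.rpow_neg_one]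
    field_simp
    ring

end Multicast

theorem theorem1 {M N K : ℕ} (hK : 0 < K) (X : Multicast.Constellation M) (θ : Fin N → ℝ)
    (R : Fin K → Matrix (Fin N) (Fin N) ℂ) (hR : ∀ k, (R k).PosSemidef)
    (hgain : ∀ k, 0 < Multicast.beamGain (R k) (Multicast.beamformer θ))
    {Ω : Type*} [MeasurableSpace Ω] (P : Measure Ω) [IsProbabilityMeasure P]
    (h : Fin K → Ω → Fin N → ℂ)
    (hlaw : ∀ k, HasLaw (h k) (Multicast.complexGaussianVector (R k)) P)
    (hindep : iIndepFun h P) :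
    -- the multicast rate is `I(min_k γ_k)`, and its expectation exists
    (∀ γbar : ℝ, 0 < γbar →
      (∀ ω, Multicast.multicastRate X γbar (Multicast.beamformer θ) (fun k => h k ω) =
        X.mutualInfo (⨅ k, Multicast.receivedSNR γbar (Multicast.beamformer θ) (h k ω))) ∧
      Integrable (fun ω =>
        Multicast.multicastRate X γbar (Multicast.beamformer θ) (fun k => h k ω)) P) ∧
    -- `MMSE = dI/dx` exists on `(0, ∞)` and the integral of `x * MMSE x` converges
    (∀ x : ℝ, 0 < x → DifferentiableAt ℝ X.mutualInfo x) ∧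
    IntegrableOn (fun x : ℝ => x * X.mmse x) (Set.Ioi 0) ∧
    -- the constant `d_non` is positive and finite
    0 < X.mmseMellinTwo ∧
    0 < Multicast.arrayGainNon X (Multicast.beamformer θ) R ∧
    -- the high-SNR asymptotics
    (fun γbar : ℝ =>
      Multicast.averageMulticastRate P X γbar (Multicast.beamformer θ) h -
        (Real.logb 2 M -
          1 / (Multicast.arrayGainNon X (Multicast.beamformer θ) R * γbar)))
      =o[atTop] (fun γbar : ℝ => 1 / γbar) ∧
    -- the diversity order is `1` and the array gain is `d_non`
    (∀ Gd Gc : ℝ,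
      Multicast.HasDiversityOrderAndArrayGain
        (fun γbar : ℝ => Multicast.averageMulticastRate P X γbar (Multicast.beamformer θ) h) Gd Gc ↔
      Gd = 1 ∧ Gc = Multicast.arrayGainNon X (Multicast.beamformer θ) R) := by
  have hne : Nonempty (Fin K) := ⟨⟨0, hK⟩⟩
  have hd : 0 < Multicast.arrayGainNon X (Multicast.beamformer θ) R :=
    one_div_pos.2 (mul_pos X.mmseMellinTwo_pos
      (Finset.sum_pos (fun k _ => one_div_pos.2 (hgain k)) Finset.univ_nonempty))
  have hlim := Multicast.tendsto_mul_averageMulticastRate hK X hR hgain hlaw hindep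
  rw [← one_div_one_div (X.mmseMellinTwo * _), ← Multicast.arrayGainNon] at hlim
  refine ⟨fun γbar hγ => ⟨fun ω => Multicast.multicastRate_eq hK X γbar _ _,
    Multicast.integrable_multicastRate hK X
      (Multicast.map_iInf_gain hK hR hgain hlaw hindep).1 hγ⟩,
    fun x hx => X.differentiableAt_mutualInfo hx, X.integrableOn_mul_mmse, X.mmseMellinTwo_pos,
    hd, ?_, Multicast.hasDiversityOrderAndArrayGain_iff hd hlim⟩
  have ho := (Multicast.isLittleO_rpow_neg_iff (fun γbar : ℝ =>
    Multicast.averageMulticastRate P X γbar (Multicast.beamformer θ) h -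
      (Real.logb 2 M - 1 / (Multicast.arrayGainNon X (Multicast.beamformer θ) R * γbar))) 1).2 ?_
  · simpa only [Real.rpow_neg_one, one_div] using ho
  · have h0 := hlim.add_const (1 / Multicast.arrayGainNon X (Multicast.beamformer θ) R)
    rw [neg_add_cancel] at h0
    refine h0.congr' ?_
    filter_upwards [eventually_gt_atTop 0] with γ hγ
    rw [Real.rpow_one]
    field_simp
    ring
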